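/- A \emph{gyrogroup} is a set $G$ with a binary operation $\oplus$ such that: there is a unique element $0\in G$ with $0\oplus a=a=a\oplus 0$ for all $a\in G$; every $x\in G$ has a unique inverse $\ominus x$ with $\ominus x\oplus x=0=x\oplus(\ominus x)$; and for all $x,y\in G$ there is an automorphism $\operatorname{gyr}[x,y]$ of $(G,\oplus)$ such that $x\oplus(y\oplus z)=(x\oplus y)\oplus\operatorname{gyr}[x,y](z)$ for all $z\in G$, and $\operatorname{gyr}[x\oplus y,y]=\operatorname{gyr}[x,y]$. A \emph{subgyrogroup} is a nonempty subset closed under $\oplus$ that is a gyrogroup under the restricted operation; $\langle S\rangle$ denotes the intersection of all subgyrogroups containing $S$. A \emph{strongly topological gyrogroup} is a gyrogroup with a topology for which $\oplus: G\times G\to G$ and $\ominus: G\to G$ are continuous and for which there is a neighborhood base $\mathscr U$ at $0$ such that $\operatorname{gyr}[x,y](U)=U$ for all $x,y\in G$ and $U\in\mathscr U$. A subset $S\subseteq G$ is a \emph{suitable set} for $G$ if $S$ is discrete in its subspace topology, $\langle S\rangle$ is dense in $G$, and $S\cup\{0\}$ is closed in $G$. A space is \emph{pseudocompact} if every continuous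 real-valued function on it is bounded. \textbf{Theorem.} Let $G$ be a Hausdorff strongly topological gyrogroup. If $G$ is separable and not pseudocompact, then $G$ has a suitable set that is closed in $G$. -/

import Mathlib

open Topology

/-- A gyrogroup, with `⊕`, `0`, `⊖` written `+`, `0`, `-`. The identity and the inverses are
two-sided; their uniqueness follows from the axioms. `G ≃+ G` is the set of all bijections of `G`
that preserve `+`, and no further law of `+` is implied by that notation. -/
class Gyrogroup (G : Type*) extends Add G, Zero G, Neg G where
  zero_add' : ∀ x : G, 0 + x = x
  add_zero' : ∀ x : G, x + 0 = x
  neg_add' : ∀ x : G, -x + x = 0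
  add_neg' : ∀ x : G, x + -x = 0
  /-- The gyroautomorphism `gyr[x, y]`. -/
  gyr : G → G → (G ≃+ G)
  add_gyr : ∀ x y z : G, x + (y + z) = (x + y) + gyr x y z
  gyr_loop : ∀ x y : G, gyr (x + y) y = gyr x y

namespace Gyrogroup

/-- A subgyrogroup: a nonempty subset closed under the operation which is itself a gyrogroup for
the restricted operation. (That `gyr[x, y]` restricts to a bijective homomorphism of `H` onto its
image is automatic, since `gyr[x, y]` is an automorphism of `G`.) -/
structure IsSubgyrogroup {G : Type*} [Gyrogroup G] (H : Set G) : Prop where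
  nonempty : H.Nonempty
  add_mem : ∀ x ∈ H, ∀ y ∈ H, x + y ∈ H
  isGyrogroup : ∃ inst : Gyrogroup H, ∀ x y : H, ((inst.add x y : H) : G) = (x : G) + (y : G)

/-- The subgyrogroup generated by `S`: the intersection of all subgyrogroups containing `S`. -/
def generated {G : Type*} [Gyrogroup G] (S : Set G) : Set G :=
  ⋂₀ {H : Set G | IsSubgyrogroup H ∧ S ⊆ H}

/-- A topological gyrogroup: addition is jointly continuous and inversion is continuous. -/
structure IsTopological (G : Type*) [Gyrogroup G] [TopologicalSpace G] : Prop where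
  continuous_add : Continuous fun p : G × G => p.1 + p.2
  continuous_neg : Continuous fun x : G => -x

/-- A strongly topological gyrogroup: a topological gyrogroup with a neighborhood base `𝒰` at `0`
such that `gyr[x, y](U) = U` for all `x, y` and all `U ∈ 𝒰`. -/
structure IsStronglyTopological (G : Type*) [Gyrogroup G] [TopologicalSpace G] : Prop
    extends IsTopological G where
  exists_base : ∃ 𝒰 : Set (Set G), (𝓝 (0 : G)).HasBasis (fun U => U ∈ 𝒰) id ∧
    ∀ U ∈ 𝒰, ∀ x y : G, gyr x y '' U = U

/-- A suitable set: discrete in itself, generating a dense subgyrogroup, and closed in `G` once `0`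
is added to it. -/
structure IsSuitable {G : Type*} [Gyrogroup G] [TopologicalSpace G] (S : Set G) : Prop where
  discrete : DiscreteTopology S
  dense_generated : Dense (generated S)
  isClosed_union : IsClosed (S ∪ {0})

end Gyrogroup

/-- A space is pseudocompact if every continuous real-valued function on it is bounded. -/
def IsPseudocompact (X : Type*) [TopologicalSpace X] : Prop :=
  ∀ f : X → ℝ, Continuous f → ∃ M : ℝ, ∀ x, |f x| ≤ M

/-! Let `d` be a dense sequence. It suffices to find a locally finite family of finite sets such
that every subgyrogroup containing them contains all `d n`. If `G` is not totally bounded, a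
gyration-invariant `V` admits recursively chosen `x n` for which both `x n` and `d n + x n` are
`V`-separated sequences, hence locally finite; right cancellation recovers `d n`. If `G` is totally
bounded, take `f` unbounded and invariant `V n` with `|f| ≥ n` on `x n + V n`. Finite sets `F n ⊆ V
n` with `V n ⊆ F n + V (n + 1)` reduce `d n` to a remainder `v n ∈ V n`. Translating `0`, `v n` and
`F n` by `x n` gives a family that is locally finite because `f` is continuous. -/

namespace Gyrogroup

section Algebra

variable {G : Type*} [Gyrogroup G]

theorem add_left_cancel' {x a b : G} (h : x + a = x + b) : a = b := by
  have h' : -x + (x + a) = -x + (x + b) := by rw [h]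
  rw [add_gyr, add_gyr, neg_add', zero_add', zero_add'] at h'
  exact (gyr (-x) x).injective h'

theorem gyr_zero_left (x z : G) : gyr 0 x z = z := by
  have h := add_gyr 0 x z
  rw [zero_add', zero_add'] at h
  exact (add_left_cancel' h).symm

theorem neg_add_cancel_left' (x y : G) : -x + (x + y) = y := by
  rw [add_gyr, neg_add', zero_add', ← gyr_loop, neg_add', gyr_zero_left]

theorem neg_neg' (x : G) : - -x = x := by
  apply add_left_cancel' (x := -x)
  rw [neg_add', add_neg']

theorem add_neg_cancel_left' (x y : G) : x + (-x + y) = y := by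
  have h := neg_add_cancel_left' (-x) y
  rwa [neg_neg'] at h

/-- Left translation alters a difference only by a gyration, so membership of differences in a
gyration-invariant set is translation invariant. -/
theorem neg_add_add (p w w' : G) : -(p + w) + (p + w') = gyr p w (-w + w') := by
  conv_lhs => rw [← add_neg_cancel_left' w w', add_gyr p w, neg_add_cancel_left']

/-- The right cancellation law, a consequence of the loop property. -/
theorem add_add_gyr_neg (x a : G) : (x + a) + gyr (x + a) a (-a) = x := by
  rw [gyr_loop, ← add_gyr, add_neg', add_zero']

namespace IsSubgyrogroup

variable {H : Set G}

theorem neg_mem (hH : IsSubgyrogroup H) {x : G} (hx : x ∈ H) : -x ∈ H := by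
  obtain ⟨inst, hadd⟩ := hH.isGyrogroup
  have hz : ((inst.zero : H) : G) = 0 := by
    have h := hadd inst.zero inst.zero
    rw [show inst.add inst.zero inst.zero = inst.zero from inst.zero_add' inst.zero] at h
    apply add_left_cancel' (x := ((inst.zero : H) : G))
    rw [add_zero', ← h]
  have h := hadd ⟨x, hx⟩ (inst.neg ⟨x, hx⟩)
  rw [show inst.add ⟨x, hx⟩ (inst.neg ⟨x, hx⟩) = inst.zero from inst.add_neg' ⟨x, hx⟩, hz] at h
  have h' : ((inst.neg ⟨x, hx⟩ : H) : G) = -x := by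
    apply add_left_cancel' (x := x)
    rw [add_neg', h]
  exact h' ▸ (inst.neg ⟨x, hx⟩).2

theorem gyr_mem (hH : IsSubgyrogroup H) {x y z : G} (hx : x ∈ H) (hy : y ∈ H) (hz : z ∈ H) :
    gyr x y z ∈ H := by
  have h : gyr x y z = -(x + y) + (x + (y + z)) := by
    rw [add_gyr x y z, neg_add_cancel_left']
  rw [h]
  exact hH.add_mem _ (hH.neg_mem (hH.add_mem _ hx _ hy)) _
    (hH.add_mem _ hx _ (hH.add_mem _ hy _ hz))

theorem mem_of_add_mem_left (hH : IsSubgyrogroup H) {x y : G} (hx : x ∈ H) (hxy : x + y ∈ H) :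
    y ∈ H := by
  rw [← neg_add_cancel_left' x y]
  exact hH.add_mem _ (hH.neg_mem hx) _ hxy

theorem mem_of_add_mem_right (hH : IsSubgyrogroup H) {x y : G} (hy : y ∈ H) (hxy : x + y ∈ H) :
    x ∈ H := by
  rw [← add_add_gyr_neg x y]
  exact hH.add_mem _ hxy _ (hH.gyr_mem hxy hy (hH.neg_mem hy))

end IsSubgyrogroup

end Algebra

section Topological

variable {G : Type*} [Gyrogroup G] [TopologicalSpace G]

theorem IsTopological.image_add_left_mem_nhds (hG : IsTopological G) (p : G) {W : Set G}
    (hW : W ∈ 𝓝 (0 : G)) : (fun w => p + w) '' W ∈ 𝓝 p := by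
  have hc : Continuous fun x : G => -p + x :=
    hG.continuous_add.comp (continuous_const.prodMk continuous_id)
  have h : (fun x : G => -p + x) ⁻¹' W ∈ 𝓝 p :=
    hc.continuousAt.preimage_mem_nhds (by rwa [neg_add'])
  filter_upwards [h] with x hx
  exact ⟨-p + x, hx, add_neg_cancel_left' p x⟩

theorem IsTopological.exists_nhds_neg_add_mem (hG : IsTopological G) {V : Set G}
    (hV : V ∈ 𝓝 (0 : G)) : ∃ W ∈ 𝓝 (0 : G), ∀ a ∈ W, ∀ b ∈ W, -a + b ∈ V := by
  have hc : Continuous fun q : G × G => -q.1 + q.2 :=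
    hG.continuous_add.comp ((hG.continuous_neg.comp continuous_fst).prodMk continuous_snd)
  have h : (fun q : G × G => -q.1 + q.2) ⁻¹' V ∈ 𝓝 ((0 : G), (0 : G)) :=
    hc.continuousAt.preimage_mem_nhds (by simpa only [neg_add'] using hV)
  rw [nhds_prod_eq, Filter.mem_prod_same_iff] at h
  obtain ⟨W, hW, hWV⟩ := h
  exact ⟨W, hW, fun a ha b hb => hWV (Set.mk_mem_prod ha hb)⟩

theorem IsStronglyTopological.exists_gyr_invariant_subset (hG : IsStronglyTopological G)
    {V : Set G} (hV : V ∈ 𝓝 (0 : G)) :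
    ∃ U ∈ 𝓝 (0 : G), U ⊆ V ∧ ∀ x y : G, ∀ z ∈ U, gyr x y z ∈ U := by
  obtain ⟨𝒰, hb, hinv⟩ := hG.exists_base
  obtain ⟨U, hU, hUV⟩ := hb.mem_iff.1 hV
  refine ⟨U, hb.mem_of_mem hU, hUV, fun x y z hz => ?_⟩
  rw [← hinv U hU x y]
  exact Set.mem_image_of_mem _ hz

/-- Every point has a neighborhood any two elements of which differ by an element of `V`. -/
theorem IsTopological.exists_nhds_neg_add_mem_of_gyr_invariant (hG : IsTopological G) {V : Set G}
    (hV : V ∈ 𝓝 (0 : G)) (hinv : ∀ x y : G, ∀ z ∈ V, gyr x y z ∈ V) :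
    ∃ W ∈ 𝓝 (0 : G), ∀ p : G, ∀ a ∈ (fun w => p + w) '' W, ∀ b ∈ (fun w => p + w) '' W,
      -a + b ∈ V := by
  obtain ⟨W, hW, hWV⟩ := hG.exists_nhds_neg_add_mem hV
  refine ⟨W, hW, ?_⟩
  rintro p _ ⟨w, hw, rfl⟩ _ ⟨w', hw', rfl⟩
  simp only [neg_add_add]
  exact hinv _ _ _ (hWV w hw w' hw')

/-- In a sequence of points no two of which differ by an element of `V`, points do not
accumulate. -/
theorem IsTopological.exists_nhds_subsingleton_of_separated (hG : IsTopological G) {V : Set G}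
    (hV : V ∈ 𝓝 (0 : G)) (hinv : ∀ x y : G, ∀ z ∈ V, gyr x y z ∈ V) {s : ℕ → G}
    (hs : ∀ m n, m < n → -s m + s n ∉ V) (p : G) :
    ∃ N ∈ 𝓝 p, {n | s n ∈ N}.Subsingleton := by
  obtain ⟨W, hW, hWV⟩ := hG.exists_nhds_neg_add_mem_of_gyr_invariant hV hinv
  refine ⟨_, hG.image_add_left_mem_nhds p hW, fun m hm n hn => ?_⟩
  rcases lt_trichotomy m n with h | h | h
  · exact (hs m n h (hWV p _ hm _ hn)).elim
  · exact h
  · exact (hs n m h (hWV p _ hn _ hm)).elim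

/-- A gyrogroup is totally bounded if finitely many left translates of any neighborhood of `0`
cover it. -/
def IsTotallyBounded (G : Type*) [Gyrogroup G] [TopologicalSpace G] : Prop :=
  ∀ V ∈ 𝓝 (0 : G), ∃ F : Set G, F.Finite ∧ ∀ x : G, ∃ a ∈ F, -a + x ∈ V

theorem IsTotallyBounded.exists_finite_subset (htb : IsTotallyBounded G) (hG : IsTopological G)
    {V : Set G} (hV : V ∈ 𝓝 (0 : G)) (hinv : ∀ x y : G, ∀ z ∈ V, gyr x y z ∈ V) (A : Set G) :
    ∃ F : Set G, F.Finite ∧ F ⊆ A ∧ ∀ x ∈ A, ∃ a ∈ F, -a + x ∈ V := by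
  obtain ⟨W, hW, hWV⟩ := hG.exists_nhds_neg_add_mem_of_gyr_invariant hV hinv
  obtain ⟨F, hF, hcov⟩ := htb W hW
  have hr : ∀ a : G, ∃ v : G, (∃ x ∈ A, -a + x ∈ W) → v ∈ A ∧ -a + v ∈ W := by
    intro a
    by_cases h : ∃ x ∈ A, -a + x ∈ W
    · exact ⟨h.choose, fun _ => h.choose_spec⟩
    -- Junk value: such a centre is never used to cover a point of `A`, and the intersection with
    -- `A` below keeps the finite set inside `A`.
    · exact ⟨0, fun h' => (h h').elim⟩
  choose r hr using hr
  refine ⟨r '' F ∩ A, (hF.image r).inter_of_left A, Set.inter_subset_right, fun x hx => ?_⟩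
  obtain ⟨a, ha, hax⟩ := hcov x
  obtain ⟨hrA, hrW⟩ := hr a ⟨x, hx, hax⟩
  exact ⟨r a, ⟨Set.mem_image_of_mem r ha, hrA⟩, hWV a _ ⟨_, hrW, add_neg_cancel_left' a _⟩ _
    ⟨_, hax, add_neg_cancel_left' a x⟩⟩

end Topological

end Gyrogroup

theorem LocallyFinite.isClosed_iUnion_of_finite {ι X : Type*} [TopologicalSpace X] [T1Space X]
    {A : ι → Set X} (hA : LocallyFinite A) (hfin : ∀ i, (A i).Finite) : IsClosed (⋃ i, A i) :=
  hA.isClosed_iUnion fun i => (hfin i).isClosed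

/-- Each subset of the union is again a locally finite union of finite sets, hence closed. -/
theorem LocallyFinite.discreteTopology_iUnion_of_finite {ι X : Type*} [TopologicalSpace X]
    [T1Space X] {A : ι → Set X} (hA : LocallyFinite A) (hfin : ∀ i, (A i).Finite) :
    DiscreteTopology (⋃ i, A i) := by
  refine discreteTopology_iff_forall_isClosed.2 fun T => ?_
  have hclosed : IsClosed (⋃ i, A i ∩ Subtype.val '' T) :=
    LocallyFinite.isClosed_iUnion_of_finite (hA.subset fun _ => Set.inter_subset_left)
      fun i => (hfin i).inter_of_left _
  convert hclosed.preimage continuous_subtype_val using 1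
  ext ⟨x, hx⟩
  simp only [Set.mem_iUnion] at hx
  simp [hx]

theorem exists_seq_of_forall_lt_exists {α : Type*} [Inhabited α] (r : ℕ → α → ℕ → α → Prop)
    (h : ∀ (n : ℕ) (s : ℕ → α), ∃ y, ∀ m < n, r m (s m) n y) :
    ∃ s : ℕ → α, ∀ m n, m < n → r m (s m) n (s n) := by
  choose F hF using h
  let step : (n : ℕ) → ((m : ℕ) → m < n → α) → α := fun n ih =>
    F n fun m => if hm : m < n then ih m hm else default
  let s : ℕ → α := WellFounded.fix Nat.lt_wfRel.wf step
  have hs : ∀ n, s n = F n fun m => if m < n then s m else default := fun n =>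
    WellFounded.fix_eq Nat.lt_wfRel.wf step n
  refine ⟨s, fun m n hmn => ?_⟩
  have h := hF n (fun m => if m < n then s m else default) m hmn
  rwa [if_pos hmn, ← hs n] at h

namespace Gyrogroup

variable {G : Type*} [Gyrogroup G] [TopologicalSpace G]

/-- A locally finite family of finite sets generating the elements of a dense set yields a closed
suitable set. -/
theorem exists_isSuitable_isClosed_of_locallyFinite [T1Space G] {d : ℕ → G} (hd : DenseRange d)
    {A : ℕ → Set G} (hA : LocallyFinite A) (hfin : ∀ n, (A n).Finite)
    (hgen : ∀ H : Set G, IsSubgyrogroup H → (∀ n, A n ⊆ H) → ∀ n, d n ∈ H) :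
    ∃ S : Set G, IsSuitable S ∧ IsClosed S := by
  have hc := hA.isClosed_iUnion_of_finite hfin
  refine ⟨⋃ n, A n, ⟨hA.discreteTopology_iUnion_of_finite hfin, ?_,
    hc.union isClosed_singleton⟩, hc⟩
  refine Dense.mono ?_ hd
  rintro _ ⟨n, rfl⟩ H ⟨hH, hAH⟩
  exact hgen H hH (Set.iUnion_subset_iff.1 hAH) n

theorem IsStronglyTopological.exists_isSuitable_of_not_isTotallyBounded [T1Space G]
    (hG : IsStronglyTopological G) {d : ℕ → G} (hd : DenseRange d) (htb : ¬ IsTotallyBounded G) :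
    ∃ S : Set G, IsSuitable S ∧ IsClosed S := by
  simp only [IsTotallyBounded, not_forall, not_exists, not_and] at htb
  obtain ⟨V₀, hV₀, hV₀F⟩ := htb
  obtain ⟨V, hV, hVV₀, hinv⟩ := hG.exists_gyr_invariant_subset hV₀
  have hVF : ∀ F : Set G, F.Finite → ∃ x : G, ∀ a ∈ F, -a + x ∉ V := fun F hF =>
    (hV₀F F hF).imp fun _ hx a ha h => hx a ha (hVV₀ h)
  have : Inhabited G := ⟨0⟩
  obtain ⟨x, hx⟩ := exists_seq_of_forall_lt_exists
    (fun m a n b => -a + b ∉ V ∧ -(d m + a) + (d n + b) ∉ V) (fun n s => by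
      -- The second family of centres encodes separation of the `d n + x n`: translating by `-d n`
      -- turns it into a condition on `y` alone, up to a gyration.
      obtain ⟨y, hy⟩ := hVF (s '' Set.Iio n ∪ (fun m => -d n + (d m + s m)) '' Set.Iio n)
        (((Set.finite_Iio n).image _).union ((Set.finite_Iio n).image _))
      refine ⟨y, fun m hm => ⟨hy _ (Or.inl ⟨m, hm, rfl⟩), fun hmem => ?_⟩⟩
      refine hy _ (Or.inr ⟨m, hm, rfl⟩) ?_
      have h := neg_add_add (-d n) (d m + s m) (d n + y)
      rw [neg_add_cancel_left'] at h
      simp only [h]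
      exact hinv _ _ _ hmem)
  refine exists_isSuitable_isClosed_of_locallyFinite hd
    (A := fun n => {x n, d n + x n}) (fun p => ?_) (fun n => Set.toFinite _)
    (fun H hH hAH n => ?_)
  · obtain ⟨N, hN, hNs⟩ := hG.exists_nhds_subsingleton_of_separated hV hinv
      (fun m n h => (hx m n h).1) p
    obtain ⟨N', hN', hNs'⟩ := hG.exists_nhds_subsingleton_of_separated hV hinv
      (s := fun n => d n + x n) (fun m n h => (hx m n h).2) p
    refine ⟨N ∩ N', Filter.inter_mem hN hN', (hNs.finite.union hNs'.finite).subset ?_⟩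
    rintro n ⟨y, rfl | rfl, hy⟩
    · exact Or.inl hy.1
    · exact Or.inr hy.2
  · exact hH.mem_of_add_mem_right (hAH n (Or.inl rfl)) (hAH n (Or.inr rfl))

theorem IsStronglyTopological.exists_isSuitable_of_isTotallyBounded [T1Space G]
    (hG : IsStronglyTopological G) {d : ℕ → G} (hd : DenseRange d) (htb : IsTotallyBounded G)
    (hpc : ¬ IsPseudocompact G) : ∃ S : Set G, IsSuitable S ∧ IsClosed S := by
  simp only [IsPseudocompact, not_forall, not_exists, not_le] at hpc
  obtain ⟨f, hf, hunb⟩ := hpc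
  choose x hx using fun n : ℕ => hunb n
  have hV : ∀ n : ℕ, ∃ V ∈ 𝓝 (0 : G), (∀ a b : G, ∀ z ∈ V, gyr a b z ∈ V) ∧
      (n = 0 → V = Set.univ) ∧ ∀ v ∈ V, (n : ℝ) ≤ |f (x n + v)| := by
    intro n
    rcases Nat.eq_zero_or_pos n with rfl | hn
    -- `V 0` is everything, so the reduction below can start from any element.
    · exact ⟨Set.univ, Filter.univ_mem, by simp, by simp, by simp⟩
    have hc : Continuous fun v : G => |f (x n + v)| :=
      (hf.comp (hG.continuous_add.comp (continuous_const.prodMk continuous_id))).abs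
    have hmem : {v : G | (n : ℝ) < |f (x n + v)|} ∈ 𝓝 (0 : G) :=
      (isOpen_lt continuous_const hc).mem_nhds
        (by simpa only [Set.mem_ofPred_eq, add_zero'] using hx n)
    obtain ⟨U, hU, hUs, hinv⟩ := hG.exists_gyr_invariant_subset hmem
    exact ⟨U, hU, hinv, fun h => (hn.ne' h).elim, fun v hv => (hUs hv).le⟩
  choose V hV hinv hV0 hfV using hV
  choose F hF hFV hcov using fun n =>
    htb.exists_finite_subset hG.toIsTopological (hV (n + 1)) (hinv (n + 1)) (V n)
  have hrem : ∀ (n : ℕ) (c : G), ∃ v ∈ V n, ∀ H : Set G, IsSubgyrogroup H →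
      (∀ i, F i ⊆ H) → v ∈ H → c ∈ H := by
    intro n c
    induction n with
    | zero => exact ⟨c, hV0 0 rfl ▸ Set.mem_univ c, fun _ _ _ h => h⟩
    | succ n ih =>
      obtain ⟨v, hv, hvH⟩ := ih
      obtain ⟨a, ha, hav⟩ := hcov n v hv
      refine ⟨-a + v, hav, fun H hH hFH hmem => hvH H hH hFH ?_⟩
      exact hH.mem_of_add_mem_left (hH.neg_mem (hFH n ha)) hmem
  choose v hvV hv using fun n => hrem n (d n)
  refine exists_isSuitable_isClosed_of_locallyFinite hd
    -- Including `0` puts `x n` itself in the set, so it can be cancelled to recover `v n` and `F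
    -- n`.
    (A := fun n => (fun e => x n + e) '' insert 0 (insert (v n) (F n))) (fun p => ?_)
    (fun n => (((hF n).insert _).insert _).image _) (fun H hH hAH n => ?_)
  · refine ⟨{q | |f q| < |f p| + 1},
      (isOpen_lt hf.abs continuous_const).mem_nhds (by simp), ?_⟩
    obtain ⟨M, hM⟩ := exists_nat_ge (|f p| + 1)
    refine (Set.finite_Iio M).subset ?_
    rintro n ⟨_, ⟨e, he, rfl⟩, hlt⟩
    have heV : e ∈ V n := by
      rcases he with rfl | rfl | he
      · exact mem_of_mem_nhds (hV n)
      · exact hvV n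
      · exact hFV n he
    have : (n : ℝ) < M := (hfV n e heV).trans_lt (lt_of_lt_of_le hlt hM)
    exact_mod_cast this
  · have hxH : ∀ i, x i ∈ H := fun i => by
      have := hAH i ⟨0, Or.inl rfl, rfl⟩
      simpa only [add_zero'] using this
    have hmem : ∀ i, ∀ e ∈ insert (v i) (F i), e ∈ H := fun i e he =>
      hH.mem_of_add_mem_left (hxH i) (hAH i ⟨e, Or.inr he, rfl⟩)
    exact hv n H hH (fun i e he => hmem i e (Or.inr he)) (hmem n _ (Or.inl rfl))

end Gyrogroup

/-- A separable, non-pseudocompact (Hausdorff) strongly topological gyrogroup has a closed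
suitable set. -/
theorem mainTheorem3 {G : Type*} [Gyrogroup G] [TopologicalSpace G] [T2Space G]
    [TopologicalSpace.SeparableSpace G]
    (hG : Gyrogroup.IsStronglyTopological G) (hpc : ¬ IsPseudocompact G) :
    ∃ S : Set G, Gyrogroup.IsSuitable S ∧ IsClosed S := by
  have : Nonempty G := ⟨0⟩
  have hd := TopologicalSpace.denseRange_denseSeq G
  by_cases htb : Gyrogroup.IsTotallyBounded G
  · exact hG.exists_isSuitable_of_isTotallyBounded hd htb hpc
  · exact hG.exists_isSuitable_of_not_isTotallyBounded hd htb
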